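/- Let $M$ be an $n$-dimensional smooth manifold and let $f : M \to \mathbb{R}$ be a positive smooth function. For a differential form $\varphi$ of degree $r$ put $d_f\varphi = f\,d\varphi - r\,df\wedge\varphi$. Let $r \ge 1$, let $U \subseteq M$ be open, and let $\varphi$ be a smooth $r$-form on $U$ with $d_f\varphi = 0$ on $U$. Then every point of $U$ has an open neighbourhood $U' \subseteq U$ on which there is a smooth $(r-1)$-form $\psi$ with $$\varphi \wedge df = d\psi \wedge df \quad\text{on } U',$$ that is, $\varphi$ is locally $d$-exact modulo $df$. -/

import Mathlib

open scoped Manifold ContDiff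

noncomputable section

namespace ManifoldForm

/-! ### Exterior algebra of a topological real vector space -/

section Wedge

variable {E : Type*} [AddCommGroup E] [Module ℝ E] [TopologicalSpace E]

/-- The tensor product `(α ⊗ β)(v₁, …, v_{p+q}) = α(v₁, …, v_p) * β(v_{p+1}, …, v_{p+q})`
of two alternating forms, as a multilinear form. -/
def tensor {p q : ℕ} (α : E [⋀^Fin p]→L[ℝ] ℝ) (β : E [⋀^Fin q]→L[ℝ] ℝ) :
    ContinuousMultilinearMap ℝ (fun _ : Fin (p + q) => E) ℝ where
  toMultilinearMap := ((LinearMap.mul' ℝ ℝ).compMultilinearMap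
    (α.toMultilinearMap.domCoprod β.toMultilinearMap)).domDomCongr finSumFinEquiv
  cont := by
    change Continuous fun v : Fin (p + q) → E =>
      α (fun i => v (finSumFinEquiv (Sum.inl i))) * β (fun i => v (finSumFinEquiv (Sum.inr i)))
    exact (α.cont.comp (by fun_prop)).mul (β.cont.comp (by fun_prop))

theorem tensor_apply {p q : ℕ} (α : E [⋀^Fin p]→L[ℝ] ℝ) (β : E [⋀^Fin q]→L[ℝ] ℝ)
    (v : Fin (p + q) → E) :
    tensor α β v = α (fun i => v (Fin.castAdd q i)) * β (fun i => v (Fin.natAdd p i)) :=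
  rfl

/-- The wedge product of a `p`-form and a `q`-form,
`(α ∧ β)(v₁, …, v_{p+q}) =
  1 / (p! q!) * ∑_σ sign σ * α(v_{σ 1}, …, v_{σ p}) * β(v_{σ (p+1)}, …, v_{σ (p+q)})`,
the sum being over all permutations `σ`. -/
def wedge {p q : ℕ} (α : E [⋀^Fin p]→L[ℝ] ℝ) (β : E [⋀^Fin q]→L[ℝ] ℝ) :
    E [⋀^Fin (p + q)]→L[ℝ] ℝ :=
  ((p.factorial : ℝ) * (q.factorial : ℝ))⁻¹ •
    ContinuousMultilinearMap.alternatization (tensor α β)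

theorem wedge_apply {p q : ℕ} (α : E [⋀^Fin p]→L[ℝ] ℝ) (β : E [⋀^Fin q]→L[ℝ] ℝ)
    (v : Fin (p + q) → E) :
    wedge α β v = ((p.factorial : ℝ) * (q.factorial : ℝ))⁻¹ * ∑ σ : Equiv.Perm (Fin (p + q)),
      Equiv.Perm.sign σ • (α (fun i => v (σ (Fin.castAdd q i))) *
        β (fun i => v (σ (Fin.natAdd p i)))) := by
  simp [wedge, ContinuousMultilinearMap.alternatization_apply_apply, tensor_apply]

/-- The same form with its arguments indexed by `Fin q`, where `p = q`. -/
def castDeg {p q : ℕ} (h : p = q) (α : E [⋀^Fin p]→L[ℝ] ℝ) : E [⋀^Fin q]→L[ℝ] ℝ where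
  toContinuousMultilinearMap := α.toContinuousMultilinearMap.domDomCongr (finCongr h)
  map_eq_zero_of_eq' v i j hv hij :=
    α.map_eq_zero_of_eq (fun k => v (finCongr h k)) (i := (finCongr h).symm i)
      (j := (finCongr h).symm j) (by simpa using hv) (by simpa using hij)

theorem castDeg_apply {p q : ℕ} (h : p = q) (α : E [⋀^Fin p]→L[ℝ] ℝ) (v : Fin q → E) :
    castDeg h α v = α (fun i => v (Fin.cast h i)) :=
  rfl

end Wedge

/-! ### Differential forms on a smooth manifold -/

section Manifold

variable {n : ℕ} {M : Type*} [TopologicalSpace M] [ChartedSpace (EuclideanSpace ℝ (Fin n)) M]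

/-- A (not necessarily smooth) differential form of degree `r` on the `n`-dimensional
manifold `M`: an alternating `r`-linear form on each tangent space. -/
abbrev Form (n : ℕ) (M : Type*) [TopologicalSpace M] [ChartedSpace (EuclideanSpace ℝ (Fin n)) M]
    (r : ℕ) : Type _ :=
  ∀ x : M, TangentSpace (𝓡 n) x [⋀^Fin r]→L[ℝ] ℝ

/-- The expression of a form in the chart `c`, that is, its pullback along `c⁻¹`, a form on the
model space (meaningful on the target of `c`). -/
def Form.inChart {r : ℕ} (φ : Form n M r)
    (c : OpenPartialHomeomorph M (EuclideanSpace ℝ (Fin n))) (y : EuclideanSpace ℝ (Fin n)) :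
    EuclideanSpace ℝ (Fin n) [⋀^Fin r]→L[ℝ] ℝ :=
  (φ (c.symm y)).compContinuousLinearMap (mfderiv (𝓡 n) (𝓡 n) c.symm y)

/-- The form `φ` is smooth (`C^∞`) on `U`: so is its expression in every chart of the atlas. -/
def Form.SmoothOn {r : ℕ} (φ : Form n M r) (U : Set M) : Prop :=
  ∀ c ∈ atlas (EuclideanSpace ℝ (Fin n)) M,
    ContDiffOn ℝ ∞ (φ.inChart c) (c.target ∩ c.symm ⁻¹' U)

/-- The exterior derivative of a form: at `x` it is the exterior derivative of the expression of
the form in the preferred chart at `x`, pulled back by this chart. -/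
def Form.d {r : ℕ} (φ : Form n M r) : Form n M (r + 1) := fun x =>
  (extDeriv (φ.inChart (chartAt (EuclideanSpace ℝ (Fin n)) x))
    (chartAt (EuclideanSpace ℝ (Fin n)) x x)).compContinuousLinearMap
      (mfderiv (𝓡 n) (𝓡 n) (chartAt (EuclideanSpace ℝ (Fin n)) x) x)

/-- The differential `df` of a function, as a form of degree one. -/
def diff (n : ℕ) {M : Type*} [TopologicalSpace M] [ChartedSpace (EuclideanSpace ℝ (Fin n)) M]
    (f : M → ℝ) : Form n M 1 := fun x =>
  ContinuousAlternatingMap.ofSubsingleton ℝ (TangentSpace (𝓡 n) x) ℝ (0 : Fin 1)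
    (mvfderiv (𝓡 n) f x)

/-- The pointwise wedge product of two forms. -/
def Form.wedge {p q : ℕ} (φ : Form n M p) (ψ : Form n M q) : Form n M (p + q) := fun x =>
  ManifoldForm.wedge (φ x) (ψ x)

/-- The operator `d_f φ = f dφ - r df ∧ φ` attached to the function `f`, on forms `φ` of
degree `r`. -/
def Form.dAttached (f : M → ℝ) {r : ℕ} (φ : Form n M r) : Form n M (r + 1) := fun x =>
  f x • φ.d x - (r : ℝ) • castDeg (Nat.add_comm 1 r) ((diff n f).wedge φ x)

end Manifold

end ManifoldForm

end

noncomputable section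

namespace ManifoldForm

/-! ### Wedge products with a one-form, as alternatizations. -/

section Algebra

variable {E : Type*} [AddCommGroup E] [Module ℝ E] [TopologicalSpace E]
variable {F : Type*} [AddCommGroup F] [Module ℝ F] [TopologicalSpace F]

/-! The operator `d_f` is `d` conjugated by a power of `f`: in degree `r + 1`, `d(f^{-(r+1)} φ) =
f^{-(r+2)} (f dφ - (r+1) df ∧ φ)`. Hence `d_f φ = 0` makes `f^{-(r+1)} φ` closed, and the Poincaré
lemma gives `φ = f^{r+1} dη` locally. With `ψ = f^{r+1} η` one gets `dψ = φ + (r+1) f^r df ∧ η`, and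
wedging with `df` kills the last term.

This computation is `exists_wedge_eq_extDeriv_wedge`, on an open subset of a vector space; it rests
on `exists_extDeriv_eq_of_extDeriv_eq_zero`, proved by integrating along rays. Passing to a manifold
requires that `d`, the wedge product and smoothness can be read in a single chart
(`Form.d_eq_extDeriv_inChart`, `wedge_compContinuousLinearMap`, `smoothOn_ofChart`). -/

theorem wedge_compContinuousLinearMap {p q : ℕ} (α : F [⋀^Fin p]→L[ℝ] ℝ)
    (β : F [⋀^Fin q]→L[ℝ] ℝ) (L : E →L[ℝ] F) :
    (wedge α β).compContinuousLinearMap L =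
      wedge (α.compContinuousLinearMap L) (β.compContinuousLinearMap L) := by
  ext v
  simp only [ContinuousAlternatingMap.compContinuousLinearMap_apply, wedge_apply]
  rfl

theorem castDeg_compContinuousLinearMap {p q : ℕ} (h : p = q) (α : F [⋀^Fin p]→L[ℝ] ℝ)
    (L : E →L[ℝ] F) :
    (castDeg h α).compContinuousLinearMap L = castDeg h (α.compContinuousLinearMap L) :=
  rfl

/-- A permutation of `Fin (k + 1)` is determined by the image of `0` and by the permutation it
induces on the remaining points. -/
def permOfHead {k : ℕ} (x : Fin (k + 1) × Equiv.Perm (Fin k)) : Equiv.Perm (Fin (k + 1)) :=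
  x.1.cycleRange.symm * Equiv.Perm.decomposeFin.symm (0, x.2)

theorem permOfHead_zero {k : ℕ} (x : Fin (k + 1) × Equiv.Perm (Fin k)) :
    permOfHead x 0 = x.1 := by
  simp [permOfHead]

theorem permOfHead_succ {k : ℕ} (x : Fin (k + 1) × Equiv.Perm (Fin k)) (i : Fin k) :
    permOfHead x i.succ = x.1.succAbove (x.2 i) := by
  simp [permOfHead, Equiv.Perm.decomposeFin_symm_apply_succ]

theorem sign_permOfHead {k : ℕ} (x : Fin (k + 1) × Equiv.Perm (Fin k)) :
    Equiv.Perm.sign (permOfHead x) = (-1) ^ (x.1 : ℕ) * Equiv.Perm.sign x.2 := by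
  simp [permOfHead, Equiv.Perm.sign_symm]

theorem permOfHead_bijective (k : ℕ) : Function.Bijective (permOfHead (k := k)) := by
  rw [Fintype.bijective_iff_injective_and_card]
  constructor
  · rintro ⟨i, e⟩ ⟨j, e'⟩ h
    have hij : i = j := by
      have := congrArg (fun σ => σ 0) h
      simpa [permOfHead_zero] using this
    subst hij
    congr 1
    ext l : 1
    have := congrArg (fun σ => σ l.succ) h
    simpa [permOfHead_succ] using this
  · simp [Fintype.card_perm, Nat.factorial_succ]

/-- Group the permutations by `σ 0 = i`. Within a group they differ by a permutation of the
arguments of `γ`, whose sign alternation absorbs, so the `k!` terms are equal. -/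
theorem sum_perm_head_mul {k : ℕ} (a : E → ℝ) (γ : E [⋀^Fin k]→L[ℝ] ℝ) (v : Fin (k + 1) → E) :
    ∑ σ : Equiv.Perm (Fin (k + 1)),
      Equiv.Perm.sign σ • (a (v (σ 0)) * γ (fun i => v (σ i.succ))) =
    (k.factorial : ℝ) * ∑ i : Fin (k + 1), (-1) ^ (i : ℕ) * (a (v i) * γ (i.removeNth v)) := by
  rw [← (permOfHead_bijective k).sum_comp, Fintype.sum_prod_type, Finset.mul_sum]
  refine Finset.sum_congr rfl fun i _ => ?_
  have key : ∀ e : Equiv.Perm (Fin k),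
      Equiv.Perm.sign (permOfHead (i, e)) • (a (v (permOfHead (i, e) 0)) *
        γ (fun l => v (permOfHead (i, e) l.succ))) =
      (-1) ^ (i : ℕ) * (a (v i) * γ (i.removeNth v)) := by
    intro e
    have h1 : γ (fun l => v (permOfHead (i, e) l.succ)) =
        Equiv.Perm.sign e • γ (i.removeNth v) := by
      have := γ.toAlternatingMap.map_perm (i.removeNth v) e
      simp only [permOfHead_succ]
      exact this
    rw [h1, permOfHead_zero, sign_permOfHead]
    rcases Int.units_eq_one_or (Equiv.Perm.sign e) with h | h <;>
      rcases neg_one_pow_eq_or ℤˣ (i : ℕ) with h' | h' <;>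
      rcases Nat.even_or_odd (i : ℕ) with h2 | h2 <;>
      simp_all [Units.smul_def]
  rw [Finset.sum_congr rfl fun e _ => key e]
  simp [Fintype.card_perm]

theorem castDeg_wedge_ofSubsingleton_left {k : ℕ} (a : E →L[ℝ] ℝ) (γ : E [⋀^Fin k]→L[ℝ] ℝ)
    (v : Fin (k + 1) → E) :
    castDeg (Nat.add_comm 1 k)
      (wedge (ContinuousAlternatingMap.ofSubsingleton ℝ E ℝ (0 : Fin 1) a) γ) v =
    ∑ i : Fin (k + 1), (-1) ^ (i : ℕ) * (a (v i) * γ (i.removeNth v)) := by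
  have hk : (k.factorial : ℝ) ≠ 0 := by positivity
  rw [castDeg_apply, wedge_apply]
  have h := sum_perm_head_mul a γ v
  rw [← (Equiv.permCongr (finCongr (Nat.add_comm 1 k))).sum_comp] at h
  have h2 : ∀ σ : Equiv.Perm (Fin (1 + k)),
      Equiv.Perm.sign ((finCongr (Nat.add_comm 1 k)).permCongr σ) •
        (a (v ((finCongr (Nat.add_comm 1 k)).permCongr σ 0)) *
          γ (fun i => v ((finCongr (Nat.add_comm 1 k)).permCongr σ i.succ))) =
      Equiv.Perm.sign σ • (ContinuousAlternatingMap.ofSubsingleton ℝ E ℝ (0 : Fin 1) a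
        (fun i => v (Fin.cast (Nat.add_comm 1 k) (σ (Fin.castAdd k i)))) *
        γ (fun i => v (Fin.cast (Nat.add_comm 1 k) (σ (Fin.natAdd 1 i))))) := by
    intro σ
    have h0 : Fin.cast (Nat.add_comm 1 k).symm (0 : Fin (k + 1)) = Fin.castAdd k (0 : Fin 1) := by
      ext; simp
    have h1 : ∀ i : Fin k, Fin.cast (Nat.add_comm 1 k).symm i.succ = Fin.natAdd 1 i := by
      intro i; ext; simp [Nat.add_comm]
    simp only [Equiv.Perm.sign_permCongr, Equiv.permCongr_apply, finCongr_symm, finCongr_apply,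
      ContinuousAlternatingMap.ofSubsingleton_apply_apply, h0, h1]
  rw [Finset.sum_congr rfl fun σ _ => h2 σ] at h
  rw [h]
  simp [hk]

theorem wedge_ofSubsingleton_right {k : ℕ} (γ : E [⋀^Fin k]→L[ℝ] ℝ) (a : E →L[ℝ] ℝ)
    (v : Fin (k + 1) → E) :
    wedge γ (ContinuousAlternatingMap.ofSubsingleton ℝ E ℝ (0 : Fin 1) a) v =
    (-1) ^ k * ∑ i : Fin (k + 1), (-1) ^ (i : ℕ) * (a (v i) * γ (i.removeNth v)) := by
  have hk : (k.factorial : ℝ) ≠ 0 := by positivity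
  have h := sum_perm_head_mul a γ v
  -- The cycle `finRotate (k + 1)`, of sign `(-1) ^ k`, exchanges the convention "one-form first"
  -- for "one-form last".
  rw [← Equiv.sum_comp (Equiv.mulRight (finRotate (k + 1)).symm)] at h
  have h0 : (finRotate (k + 1)).symm 0 = Fin.natAdd k (0 : Fin 1) := by
    rw [Equiv.symm_apply_eq]
    exact finRotate_last.symm
  have h1 : ∀ i : Fin k, (finRotate (k + 1)).symm i.succ = Fin.castAdd 1 i := by
    intro i
    rw [Equiv.symm_apply_eq]
    exact (finRotate_of_lt i.2).symm
  have h2 : ∀ σ : Equiv.Perm (Fin (k + 1)),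
      Equiv.Perm.sign (Equiv.mulRight (finRotate (k + 1)).symm σ) •
        (a (v (Equiv.mulRight (finRotate (k + 1)).symm σ 0)) *
          γ (fun i => v (Equiv.mulRight (finRotate (k + 1)).symm σ i.succ))) =
      (-1) ^ k * (Equiv.Perm.sign σ • (γ (fun i => v (σ (Fin.castAdd 1 i))) *
        ContinuousAlternatingMap.ofSubsingleton ℝ E ℝ (0 : Fin 1) a
          (fun i => v (σ (Fin.natAdd k i))))) := by
    intro σ
    simp only [Equiv.coe_mulRight, Equiv.Perm.mul_apply, h0, h1, Equiv.Perm.sign_mul,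
      Equiv.Perm.sign_symm, sign_finRotate, Nat.add_sub_cancel,
      ContinuousAlternatingMap.ofSubsingleton_apply_apply]
    rcases Int.units_eq_one_or (Equiv.Perm.sign σ) with h | h <;>
      rcases Nat.even_or_odd k with h' | h' <;>
      simp [h, h'.neg_one_pow, mul_comm]
  rw [Finset.sum_congr rfl fun σ _ => h2 σ, ← Finset.mul_sum] at h
  rw [wedge_apply]
  have h3 : ((-1 : ℝ) ^ k) * (-1) ^ k = 1 := by rw [← mul_pow]; simp
  generalize (∑ σ : Equiv.Perm (Fin (k + 1)), _ : ℝ) = S at h ⊢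
  generalize (∑ i : Fin (k + 1), _ : ℝ) = T at h ⊢
  have h4 : S = k.factorial * ((-1) ^ k * T) := by
    linear_combination (-1 : ℝ) ^ k * h - S * h3
  rw [h4]
  simp [hk]

end Algebra

section NormedAlgebra

variable {E : Type*} [NormedAddCommGroup E] [NormedSpace ℝ E]

/-- Since `extDeriv` is the alternatization of `fderiv`, this puts `df ∧ φ` and `dφ` in the same
language. -/
theorem castDeg_wedge_eq_alternatizeUncurryFin {k : ℕ} (a : E →L[ℝ] ℝ)
    (γ : E [⋀^Fin k]→L[ℝ] ℝ) :
    castDeg (Nat.add_comm 1 k)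
      (wedge (ContinuousAlternatingMap.ofSubsingleton ℝ E ℝ (0 : Fin 1) a) γ) =
    ContinuousAlternatingMap.alternatizeUncurryFin (a.smulRight γ) := by
  ext v
  rw [castDeg_wedge_ofSubsingleton_left, ContinuousAlternatingMap.alternatizeUncurryFin_apply]
  simp

theorem wedge_ofSubsingleton_eq_alternatizeUncurryFin {k : ℕ} (γ : E [⋀^Fin k]→L[ℝ] ℝ)
    (a : E →L[ℝ] ℝ) :
    wedge γ (ContinuousAlternatingMap.ofSubsingleton ℝ E ℝ (0 : Fin 1) a) =
    (-1 : ℝ) ^ k • ContinuousAlternatingMap.alternatizeUncurryFin (a.smulRight γ) := by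
  ext v
  rw [wedge_ofSubsingleton_right, ContinuousAlternatingMap.smul_apply,
    ContinuousAlternatingMap.alternatizeUncurryFin_apply]
  simp

/-- This is `a ∧ a ∧ γ = 0`. It holds for the same reason as `d² = 0`: `a ⊗ a ⊗ γ` is symmetric in
its first two arguments. -/
theorem alternatizeUncurryFin_smulRight_alternatizeUncurryFin_smulRight {k : ℕ} (a : E →L[ℝ] ℝ)
    (γ : E [⋀^Fin k]→L[ℝ] ℝ) :
    ContinuousAlternatingMap.alternatizeUncurryFin
      (a.smulRight (ContinuousAlternatingMap.alternatizeUncurryFin (a.smulRight γ))) = 0 := by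
  rw [← ContinuousAlternatingMap.alternatizeUncurryFin_alternatizeUncurryFinCLM_comp_of_symmetric
    (f := a.smulRight (a.smulRight γ))]
  · congr 1
    ext1 x
    simp
  · intro x y
    simp [smul_smul, mul_comm]

end NormedAlgebra

/-! ### Smooth dependence of integrals on parameters. -/

section ParametricIntegral

universe u

variable {E : Type u} [NormedAddCommGroup E] [NormedSpace ℝ E] [FiniteDimensional ℝ E]

theorem hasFDerivAt_integral_of_contDiff {G : Type*} [NormedAddCommGroup G] [NormedSpace ℝ G]
    {F : E × ℝ → G} (hF : ContDiff ℝ 1 F) (x : E) :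
    HasFDerivAt (fun y => ∫ t in (0 : ℝ)..1, F (y, t))
      (∫ t in (0 : ℝ)..1, (fderiv ℝ F (x, t)).comp (ContinuousLinearMap.inl ℝ E ℝ)) x := by
  have hcont : Continuous fun p : E × ℝ =>
      (fderiv ℝ F p).comp (ContinuousLinearMap.inl ℝ E ℝ) :=
    (hF.continuous_fderiv one_ne_zero).clm_comp continuous_const
  -- Closed balls are compact in finite dimension, so the continuous derivative has a constant
  -- dominating bound.
  obtain ⟨C, hC⟩ := ((isCompact_closedBall x 1).prod
    (isCompact_Icc (a := (0 : ℝ)) (b := 1))).exists_bound_of_continuousOn hcont.continuousOn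
  refine intervalIntegral.hasFDerivAt_integral_of_dominated_of_fderiv_le
    (s := Metric.closedBall x 1) (bound := fun _ => C)
    (F' := fun y t => (fderiv ℝ F (y, t)).comp (ContinuousLinearMap.inl ℝ E ℝ))
    (Metric.closedBall_mem_nhds x one_pos) ?_ ?_ ?_ ?_ ?_ ?_
  · refine Filter.Eventually.of_forall fun y => Continuous.aestronglyMeasurable ?_
    exact hF.continuous.comp (by fun_prop)
  · exact (hF.continuous.comp (by fun_prop)).intervalIntegrable _ _
  · exact (hcont.comp (by fun_prop : Continuous fun t : ℝ => (x, t))).aestronglyMeasurable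
  · refine Filter.Eventually.of_forall fun t ht y hy => hC (y, t) ⟨hy, ?_⟩
    rw [Set.uIoc_of_le zero_le_one] at ht
    exact ⟨ht.1.le, ht.2⟩
  · exact intervalIntegrable_const
  · refine Filter.Eventually.of_forall fun t _ y _ => ?_
    have h := (hF.differentiable one_ne_zero (y, t)).hasFDerivAt
    exact h.comp y (hasFDerivAt_prodMk_left y t)

/-- The fundamental theorem of calculus for a linear image of the derivative of an integral with
parameters. -/
theorem map_fderiv_integral_eq_sub {G G' : Type*} [NormedAddCommGroup G] [NormedSpace ℝ G]
    [CompleteSpace G] [NormedAddCommGroup G'] [NormedSpace ℝ G'] [CompleteSpace G']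
    {F : E × ℝ → G} (hF : ContDiff ℝ 1 F) (A : (E →L[ℝ] G) →L[ℝ] G') {Φ : ℝ → G'} {y : E}
    (hΦ : ∀ t ∈ Set.uIcc (0 : ℝ) 1, HasDerivAt Φ
      (A ((fderiv ℝ F (y, t)).comp (ContinuousLinearMap.inl ℝ E ℝ))) t) :
    A (fderiv ℝ (fun y => ∫ t in (0 : ℝ)..1, F (y, t)) y) = Φ 1 - Φ 0 := by
  have hcont : Continuous fun t : ℝ =>
      (fderiv ℝ F (y, t)).comp (ContinuousLinearMap.inl ℝ E ℝ) :=
    ((hF.continuous_fderiv one_ne_zero).comp (by fun_prop)).clm_comp continuous_const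
  rw [(hasFDerivAt_integral_of_contDiff hF y).fderiv,
    ← A.intervalIntegral_comp_comm (hcont.intervalIntegrable _ _),
    intervalIntegral.integral_eq_sub_of_hasDerivAt hΦ
      ((A.continuous.comp hcont).intervalIntegrable _ _)]

/-- The derivative is again such an integral, with values in `E →L[ℝ] G`. The induction therefore
varies `G`, which must share the universe of `E`. -/
theorem contDiff_integral_of_contDiff {G : Type u} [NormedAddCommGroup G] [NormedSpace ℝ G]
    {F : E × ℝ → G} (hF : ContDiff ℝ ∞ F) :
    ContDiff ℝ ∞ (fun y => ∫ t in (0 : ℝ)..1, F (y, t)) := by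
  rw [contDiff_infty]
  intro n
  induction n generalizing G with
  | zero =>
    have h : Differentiable ℝ (fun y => ∫ t in (0 : ℝ)..1, F (y, t)) := fun x =>
      (hasFDerivAt_integral_of_contDiff (hF.of_le (by simp)) x).differentiableAt
    exact contDiff_zero.2 h.continuous
  | succ n ih =>
    have h := hasFDerivAt_integral_of_contDiff (hF.of_le (by simp))
    push_cast
    rw [contDiff_succ_iff_fderiv]
    refine ⟨fun x => (h x).differentiableAt, by simp, ?_⟩
    rw [funext fun x => (h x).fderiv]
    exact ih ((hF.fderiv_right (m := ∞) (by simp)).clm_comp contDiff_const)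

end ParametricIntegral

/-! ### The Poincaré lemma, and local exactness modulo `dg` in a vector space. -/

section Poincare

open ContinuousAlternatingMap

section

variable {E : Type*} [NormedAddCommGroup E] [NormedSpace ℝ E]

/-- Cartan's formula for a constant field `u`, with `D` as the derivative of a form: the term of
index `0` is `D u`, and the others carry the sign shifted by one. -/
theorem curryLeft_alternatizeUncurryFin {k : ℕ} (D : E →L[ℝ] E [⋀^Fin (k + 1)]→L[ℝ] ℝ) (u : E) :
    (alternatizeUncurryFin D).curryLeft u =
      D u - alternatizeUncurryFin
        (((curryLeftLI (𝕜 := ℝ) (E := E) (F := ℝ) (n := k)).toContinuousLinearMap ∘L D).flip u) := by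
  ext v
  have h : ∀ i : Fin (k + 1), i.succ.removeNth (Matrix.vecCons u v : Fin (k + 2) → E) =
      (Matrix.vecCons u (i.removeNth v) : Fin (k + 1) → E) := by
    intro i
    ext j
    refine Fin.cases ?_ (fun j => ?_) j
    · simp [Fin.removeNth]
    · simp [Fin.removeNth]
  have h0 : (0 : Fin (k + 2)).removeNth (Matrix.vecCons u v : Fin (k + 2) → E) = v := by
    ext j
    simp [Fin.removeNth]
  rw [curryLeft_apply_apply, alternatizeUncurryFin_apply, Fin.sum_univ_succ,
    ContinuousAlternatingMap.sub_apply, alternatizeUncurryFin_apply]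
  simp [h, h0, pow_succ, sub_eq_add_neg]

theorem extDeriv_smul_function {k : ℕ} {h : E → ℝ} {α : E → E [⋀^Fin k]→L[ℝ] ℝ} {z : E}
    (hh : DifferentiableAt ℝ h z) (hα : DifferentiableAt ℝ α z) :
    extDeriv (fun x => h x • α x) z =
      alternatizeUncurryFin ((fderiv ℝ h z).smulRight (α z)) + h z • extDeriv α z := by
  rw [extDeriv, fderiv_fun_smul hh hα, alternatizeUncurryFin_add, alternatizeUncurryFin_smul]
  exact add_comm _ _

end

universe u

variable {E : Type u} [NormedAddCommGroup E] [NormedSpace ℝ E] [FiniteDimensional ℝ E]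

/-- **Poincaré lemma** on a ball, for a form that extends smoothly to the whole space. -/
theorem exists_extDeriv_eq_of_extDeriv_eq_zero {k : ℕ} {θ : E → E [⋀^Fin (k + 1)]→L[ℝ] ℝ}
    (hθ : ContDiff ℝ ∞ θ) (y₀ : E) (ε : ℝ) (hd : ∀ y ∈ Metric.ball y₀ ε, extDeriv θ y = 0) :
    ∃ η : E → E [⋀^Fin k]→L[ℝ] ℝ, ContDiff ℝ ∞ η ∧ ∀ y ∈ Metric.ball y₀ ε, extDeriv η y = θ y := by
  set K := (curryLeftLI (𝕜 := ℝ) (E := E) (F := ℝ) (n := k)).toContinuousLinearMap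
  -- Integrand of the radial homotopy operator: contraction of `θ` with `y - y₀` along the segment
  -- from `y₀` to `y`.
  set F : E × ℝ → E [⋀^Fin k]→L[ℝ] ℝ :=
    fun p => p.2 ^ k • K (θ (y₀ + p.2 • (p.1 - y₀))) (p.1 - y₀)
  have hF : ContDiff ℝ ∞ F := by
    have h : ContDiff ℝ ∞ fun p : E × ℝ => θ (y₀ + p.2 • (p.1 - y₀)) :=
      hθ.comp (g := θ) (f := fun p : E × ℝ => y₀ + p.2 • (p.1 - y₀)) (by fun_prop)
    exact (contDiff_snd.pow k).smul ((K.contDiff.comp h).clm_apply (by fun_prop))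
  refine ⟨fun y => ∫ t in (0 : ℝ)..1, F (y, t), contDiff_integral_of_contDiff hF, fun y hy => ?_⟩
  rw [extDeriv]
  have hdθ : ∀ z, HasFDerivAt θ (fderiv ℝ θ z) z := fun z =>
    (hθ.differentiable (by simp) z).hasFDerivAt
  have hpath : ∀ t : ℝ, HasFDerivAt (fun x : E => y₀ + t • (x - y₀))
      (t • ContinuousLinearMap.id ℝ E) y := fun t =>
    (((hasFDerivAt_id y).sub_const y₀).const_smul t).const_add y₀
  have hpartial : ∀ t : ℝ, (fderiv ℝ F (y, t)).comp (ContinuousLinearMap.inl ℝ E ℝ) =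
      t ^ k • (K (θ (y₀ + t • (y - y₀))) +
        t • (K ∘L fderiv ℝ θ (y₀ + t • (y - y₀))).flip (y - y₀)) := by
    intro t
    have h1 : HasFDerivAt (fun x => F (x, t))
        ((fderiv ℝ F (y, t)).comp (ContinuousLinearMap.inl ℝ E ℝ)) y :=
      HasFDerivAt.comp (g := F) y (hF.differentiable (by simp) (y, t)).hasFDerivAt
        (hasFDerivAt_prodMk_left y t)
    have h3 : HasFDerivAt (fun x => K (θ (y₀ + t • (x - y₀)))) _ y :=
      HasFDerivAt.comp (g := K) y K.hasFDerivAt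
        (HasFDerivAt.comp (g := θ) y (hdθ (y₀ + t • (y - y₀))) (hpath t))
    have h2 := (h3.clm_apply ((hasFDerivAt_id y).sub_const y₀)).const_smul (t ^ k)
    rw [h1.unique h2]
    ext1 v
    simp
  -- The exterior derivative of the integrand is a total `t`-derivative. Its primitive is `θ y` at
  -- `t = 1` and vanishes at `t = 0` because the exponent `k + 1` is positive.
  have hder : ∀ t ∈ Set.uIcc (0 : ℝ) 1, HasDerivAt (fun t : ℝ => t ^ (k + 1) • θ (y₀ + t • (y - y₀)))
      (alternatizeUncurryFinCLM ℝ E ℝ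
        ((fderiv ℝ F (y, t)).comp (ContinuousLinearMap.inl ℝ E ℝ))) t := by
    intro t ht
    rw [Set.uIcc_of_le zero_le_one] at ht
    have hmem : y₀ + t • (y - y₀) ∈ Metric.ball y₀ ε := by
      rw [mem_ball_iff_norm] at hy ⊢
      rw [add_sub_cancel_left, norm_smul, Real.norm_of_nonneg ht.1]
      exact (mul_le_of_le_one_left (norm_nonneg _) ht.2).trans_lt hy
    have hz := curryLeft_alternatizeUncurryFin (fderiv ℝ θ (y₀ + t • (y - y₀))) (y - y₀)
    have hz0 : alternatizeUncurryFin (fderiv ℝ θ (y₀ + t • (y - y₀))) = 0 := hd _ hmem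
    rw [hz0, eq_comm, show (0 : E [⋀^Fin (k + 2)]→L[ℝ] ℝ).curryLeft (y - y₀) = 0 from rfl,
      sub_eq_zero] at hz
    have hline : HasDerivAt (fun t : ℝ => y₀ + t • (y - y₀)) (y - y₀) t := by
      simpa using ((hasDerivAt_id t).smul_const (y - y₀)).const_add y₀
    have h1 := (hasDerivAt_pow (k + 1) t).smul ((hdθ _).comp_hasDerivAt t hline)
    -- Alternatizing the contraction of a `(k + 1)`-form gives `k + 1` times the form, the factor
    -- produced by differentiating `t ^ (k + 1)`; closedness, through `hz`, matches the other terms.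
    refine h1.congr_deriv ?_
    rw [hpartial, alternatizeUncurryFinCLM_apply, alternatizeUncurryFin_smul,
      alternatizeUncurryFin_add, alternatizeUncurryFin_smul, ← hz,
      show K (θ (y₀ + t • (y - y₀))) = (θ (y₀ + t • (y - y₀))).curryLeft from rfl,
      alternatizeUncurryFin_curryLeft, ← Nat.cast_smul_eq_nsmul ℝ (k + 1)]
    simp only [Function.comp_apply, Nat.add_sub_cancel]
    module
  rw [← alternatizeUncurryFinCLM_apply]
  refine (map_fderiv_integral_eq_sub (hF.of_le (by simp)) (alternatizeUncurryFinCLM ℝ E ℝ)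
    hder).trans ?_
  simp

omit [FiniteDimensional ℝ E] in
theorem contDiff_smul_of_tsupport_subset {G : Type*} [NormedAddCommGroup G] [NormedSpace ℝ G]
    {χ : E → ℝ} {α : E → G} {V : Set E} (hχ : ContDiff ℝ ∞ χ) (hV : IsOpen V)
    (hsupp : tsupport χ ⊆ V) (hα : ContDiffOn ℝ ∞ α V) : ContDiff ℝ ∞ fun x => χ x • α x := by
  rw [contDiff_iff_contDiffAt]
  intro x
  by_cases hx : x ∈ V
  · exact hχ.contDiffAt.smul (hα.contDiffAt (hV.mem_nhds hx))
  · have h0 : (fun x => χ x • α x) =ᶠ[nhds x] fun _ => 0 := by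
      have := notMem_tsupport_iff_eventuallyEq.1 fun h => hx (hsupp h)
      filter_upwards [this] with y hy
      simp [hy]
    exact contDiffAt_const.congr_of_eventuallyEq h0

/-- The local exactness modulo `dg` of forms annihilated by the operator attached to `g`, on an
open subset of a vector space. -/
theorem exists_wedge_eq_extDeriv_wedge {r : ℕ} {V : Set E} (hV : IsOpen V) {g : E → ℝ}
    (hg : ContDiffOn ℝ ∞ g V) (hpos : ∀ z ∈ V, 0 < g z) {α : E → E [⋀^Fin (r + 1)]→L[ℝ] ℝ}
    (hα : ContDiffOn ℝ ∞ α V)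
    (hd : ∀ z ∈ V, g z • extDeriv α z =
      ((r + 1 : ℕ) : ℝ) • alternatizeUncurryFin ((fderiv ℝ g z).smulRight (α z)))
    {y₀ : E} (hy₀ : y₀ ∈ V) :
    ∃ ε > 0, Metric.ball y₀ ε ⊆ V ∧ ∃ β : E → E [⋀^Fin r]→L[ℝ] ℝ,
      ContDiffOn ℝ ∞ β (Metric.ball y₀ ε) ∧ ∀ z ∈ Metric.ball y₀ ε,
        wedge (α z) (ofSubsingleton ℝ E ℝ (0 : Fin 1) (fderiv ℝ g z)) =
          wedge (extDeriv β z) (ofSubsingleton ℝ E ℝ (0 : Fin 1) (fderiv ℝ g z)) := by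
  obtain ⟨δ, hδ, hδV⟩ := Metric.isOpen_iff.1 hV y₀ hy₀
  -- The cutoff supplies the global smooth form that the Poincaré lemma takes, without changing it
  -- on the ball of radius `δ / 3`.
  let χ : ContDiffBump y₀ := ⟨δ / 3, δ / 2, by positivity, by linarith⟩
  have hball : Metric.ball y₀ (δ / 3) ⊆ V := (Metric.ball_subset_ball (by linarith)).trans hδV
  have hsupp : tsupport χ ⊆ V := by
    rw [χ.tsupport_eq]
    exact (Metric.closedBall_subset_ball (by change δ / 2 < δ; linarith)).trans hδV
  have hinv : ContDiffOn ℝ ∞ (fun x => (g x ^ (r + 1))⁻¹) V :=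
    (hg.pow (r + 1)).inv fun x hx => (pow_pos (hpos x hx) _).ne'
  have hθ : ContDiff ℝ ∞ fun x => χ x • ((g x ^ (r + 1))⁻¹ • α x) :=
    contDiff_smul_of_tsupport_subset χ.contDiff hV hsupp (hinv.smul hα)
  have hdiff : ∀ z ∈ V, DifferentiableAt ℝ g z := fun z hz =>
    (hg.contDiffAt (hV.mem_nhds hz)).differentiableAt (by simp)
  have hdiffα : ∀ z ∈ V, DifferentiableAt ℝ α z := fun z hz =>
    (hα.contDiffAt (hV.mem_nhds hz)).differentiableAt (by simp)
  have hone : ∀ z ∈ Metric.ball y₀ (δ / 3), χ z = 1 := fun z hz =>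
    χ.one_of_mem_closedBall (Metric.ball_subset_closedBall hz)
  have hclosed : ∀ z ∈ Metric.ball y₀ (δ / 3),
      extDeriv (fun x => χ x • ((g x ^ (r + 1))⁻¹ • α x)) z = 0 := by
    intro z hz
    have hzV := hball hz
    have hgz := (hpos z hzV).ne'
    have heq : (fun x => χ x • ((g x ^ (r + 1))⁻¹ • α x)) =ᶠ[nhds z]
        fun x => (g x ^ (r + 1))⁻¹ • α x := by
      filter_upwards [Metric.isOpen_ball.mem_nhds hz] with x hx
      rw [hone x hx, one_smul]
    have hh : HasFDerivAt (fun x => (g x ^ (r + 1))⁻¹) _ z :=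
      ((hasDerivAt_pow (r + 1) (g z)).inv (pow_ne_zero _ hgz)).comp_hasFDerivAt z
      (hdiff z hzV).hasFDerivAt
    have hdα : extDeriv α z = (g z)⁻¹ • (((r + 1 : ℕ) : ℝ) •
        alternatizeUncurryFin ((fderiv ℝ g z).smulRight (α z))) := by
      rw [← hd z hzV, smul_smul, inv_mul_cancel₀ hgz, one_smul]
    have hsm : ∀ c : ℝ, (c • fderiv ℝ g z).smulRight (α z) =
        c • (fderiv ℝ g z).smulRight (α z) := fun c => by
      ext1 v; simp [smul_smul]
    rw [heq.extDeriv_eq, extDeriv_smul_function (hh.differentiableAt) (hdiffα z hzV), hh.fderiv, hsm,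
      alternatizeUncurryFin_smul, hdα, smul_smul, smul_smul, ← add_smul]
    convert zero_smul ℝ _
    simp only [Nat.add_sub_cancel]
    field_simp
    ring
  obtain ⟨η, hη, hηθ⟩ := exists_extDeriv_eq_of_extDeriv_eq_zero hθ y₀ (δ / 3) hclosed
  -- Multiplying the primitive back by `g ^ (r + 1)` recovers `α`, up to a multiple of `dg ∧ η`.
  refine ⟨δ / 3, by positivity, hball, fun x => g x ^ (r + 1) • η x,
    ((hg.mono hball).pow _).smul hη.contDiffOn, fun z hz => ?_⟩
  have hzV := hball hz
  have hgz := (hpos z hzV).ne'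
  have hp : HasFDerivAt (fun x => g x ^ (r + 1)) _ z :=
    (hasDerivAt_pow (r + 1) (g z)).comp_hasFDerivAt z (hdiff z hzV).hasFDerivAt
  have hβ := extDeriv_smul_function hp.differentiableAt
    (hη.differentiable (by simp) z)
  rw [hηθ z hz, hone z hz, one_smul, smul_smul, mul_inv_cancel₀ (pow_ne_zero _ hgz), one_smul,
    hp.fderiv] at hβ
  rw [wedge_ofSubsingleton_eq_alternatizeUncurryFin,
    wedge_ofSubsingleton_eq_alternatizeUncurryFin, hβ]
  congr 1
  have hlin : (fderiv ℝ g z).smulRight (alternatizeUncurryFin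
      (((((r + 1 : ℕ) : ℝ) * g z ^ (r + 1 - 1)) • fderiv ℝ g z).smulRight (η z)) + α z) =
      (((r + 1 : ℕ) : ℝ) * g z ^ (r + 1 - 1)) • (fderiv ℝ g z).smulRight
        (alternatizeUncurryFin ((fderiv ℝ g z).smulRight (η z))) +
      (fderiv ℝ g z).smulRight (α z) := by
    have hsm : ∀ c : ℝ, (c • fderiv ℝ g z).smulRight (η z) =
        c • (fderiv ℝ g z).smulRight (η z) := fun c => by
      ext1 v; simp [smul_smul]
    ext1 v
    rw [hsm, alternatizeUncurryFin_smul]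
    simp only [ContinuousLinearMap.smulRight_apply, _root_.add_apply,
      _root_.smul_apply]
    module
  rw [hlin, alternatizeUncurryFin_add, alternatizeUncurryFin_smul,
    alternatizeUncurryFin_smulRight_alternatizeUncurryFin_smulRight, smul_zero, zero_add]

end Poincare

/-! ### Smoothness of pullbacks of alternating forms. -/

section Pullback

variable {E F : Type*} [NormedAddCommGroup E] [NormedSpace ℝ E] [FiniteDimensional ℝ E]
  [NormedAddCommGroup F] [NormedSpace ℝ F]

instance finiteDimensional_continuousMultilinearMap {r : ℕ} :
    FiniteDimensional ℝ (ContinuousMultilinearMap ℝ (fun _ : Fin r => E) ℝ) :=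
  Module.Finite.of_injective
    (ContinuousMultilinearMap.toMultilinearMapLinear (R' := ℝ) (A := ℝ) (M₁ := fun _ : Fin r => E)
      (M₂ := ℝ))
    ContinuousMultilinearMap.toMultilinearMap_injective

/-- Composition is analytic on multilinear maps. A linear left inverse of the inclusion of
alternating maps, continuous by finite dimension, brings the result back. -/
theorem contDiffAt_compContinuousLinearMap {X : Type*} [NormedAddCommGroup X] [NormedSpace ℝ X]
    {r : ℕ} {α : X → F [⋀^Fin r]→L[ℝ] ℝ} {L : X → E →L[ℝ] F} {x : X}
    {m : WithTop ℕ∞} (hα : ContDiffAt ℝ m α x) (hL : ContDiffAt ℝ m L x) :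
    ContDiffAt ℝ m (fun y => (α y).compContinuousLinearMap (L y)) x := by
  let T := ContinuousAlternatingMap.toContinuousMultilinearMapLI (𝕜 := ℝ) (E := F) (F := ℝ)
    (ι := Fin r)
  let S := ContinuousAlternatingMap.toContinuousMultilinearMapLI (𝕜 := ℝ) (E := E) (F := ℝ)
    (ι := Fin r)
  obtain ⟨R, hR⟩ := S.toLinearMap.exists_leftInverse_of_injective
    (LinearMap.ker_eq_bot.2 S.injective)
  have hm := (ContinuousMultilinearMap.analyticAt_uncurry_compContinuousLinearMap
    (𝕜 := ℝ) (Fm := fun _ : Fin r => E) (Em := fun _ : Fin r => F) (G := ℝ)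
    (q := (fun _ => L x, T (α x)))).contDiffAt (n := m)
  have hp : ContDiffAt ℝ m (fun y => ((fun _ => L y, T (α y)) :
      ((_ : Fin r) → E →L[ℝ] F) × ContinuousMultilinearMap ℝ (fun _ : Fin r => F) ℝ)) x :=
    (contDiffAt_pi.2 fun _ => hL).prodMk (T.contDiff.contDiffAt.comp x hα)
  have h := (LinearMap.toContinuousLinearMap R).contDiff.contDiffAt.comp x (hm.comp x hp)
  refine h.congr_of_eventuallyEq (Filter.Eventually.of_forall fun y => ?_)
  exact (LinearMap.congr_fun hR ((α y).compContinuousLinearMap (L y))).symm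

end Pullback

/-! ### Forms on a manifold read in an arbitrary chart. -/

section Manifold

variable {n : ℕ} {M : Type*} [TopologicalSpace M] [ChartedSpace (EuclideanSpace ℝ (Fin n)) M]
  [IsManifold (𝓡 n) ∞ M]

local notation "𝔼" => EuclideanSpace ℝ (Fin n)

/-- The derivative of a chart, with values in the model space. -/
def chartDeriv {n : ℕ} {M : Type*} [TopologicalSpace M]
    [ChartedSpace (EuclideanSpace ℝ (Fin n)) M]
    (c : OpenPartialHomeomorph M (EuclideanSpace ℝ (Fin n))) (x : M) :
    TangentSpace (𝓡 n) x →L[ℝ] EuclideanSpace ℝ (Fin n) :=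
  mfderiv (𝓡 n) (𝓡 n) c x

theorem mdifferentiable_chart {c : OpenPartialHomeomorph M 𝔼} (hc : c ∈ atlas 𝔼 M) :
    c.MDifferentiable (𝓡 n) (𝓡 n) :=
  haveI : IsManifold (𝓡 n) 1 M := IsManifold.of_le (n := ∞) (by simp)
  mdifferentiable_of_mem_atlas hc

theorem contDiffAt_transition {c c' : OpenPartialHomeomorph M 𝔼} (hc : c ∈ atlas 𝔼 M)
    (hc' : c' ∈ atlas 𝔼 M) {z : 𝔼} (hz : z ∈ c'.target) (hz' : c'.symm z ∈ c.source) :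
    ContDiffAt ℝ ∞ (c ∘ c'.symm) z := by
  rw [← contMDiffAt_iff_contDiffAt]
  have h1 := (contMDiffOn_of_mem_maximalAtlas (I := 𝓡 n) (n := ∞)
    (IsManifold.subset_maximalAtlas hc)).contMDiffAt (c.open_source.mem_nhds hz')
  have h2 := (contMDiffOn_symm_of_mem_maximalAtlas (I := 𝓡 n) (n := ∞)
    (IsManifold.subset_maximalAtlas hc')).contMDiffAt (c'.open_target.mem_nhds hz)
  exact h1.comp z h2

theorem mfderiv_symm_eq_comp_transition {c c' : OpenPartialHomeomorph M 𝔼} (hc : c ∈ atlas 𝔼 M)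
    (hc' : c' ∈ atlas 𝔼 M) {z : 𝔼} (hz : z ∈ c'.target) (hz' : c'.symm z ∈ c.source) :
    mfderiv (𝓡 n) (𝓡 n) c'.symm z =
      (mfderiv (𝓡 n) (𝓡 n) c.symm (c (c'.symm z)) : 𝔼 →L[ℝ] 𝔼).comp
        (fderiv ℝ (c ∘ c'.symm) z) := by
  have heq : c'.symm =ᶠ[nhds z] c.symm ∘ (c ∘ c'.symm) := by
    filter_upwards [(c'.symm.continuousAt hz).preimage_mem_nhds (c.open_source.mem_nhds hz'),
      c'.open_target.mem_nhds hz] with w hw _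
    exact (c.left_inv hw).symm
  have h1 : MDifferentiableAt (𝓡 n) (𝓡 n) c.symm ((c ∘ c'.symm) z) :=
    (mdifferentiable_chart hc).mdifferentiableAt_symm (c.map_source hz')
  have h2 : MDifferentiableAt (𝓡 n) (𝓡 n) (c ∘ c'.symm) z :=
    ((contDiffAt_transition hc hc' hz hz').differentiableAt (by simp)).mdifferentiableAt
  have h3 : mfderiv (𝓡 n) (𝓡 n) (c ∘ c'.symm) z = fderiv ℝ (c ∘ c'.symm) z := mfderiv_eq_fderiv
  exact heq.mfderiv_eq.trans ((mfderiv_comp z h1 h2).trans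
    (congrArg (mfderiv (𝓡 n) (𝓡 n) c.symm (c (c'.symm z)) : 𝔼 →L[ℝ] 𝔼).comp h3))

theorem inChart_eq_compContinuousLinearMap_transition {r : ℕ} (φ : Form n M r)
    {c c' : OpenPartialHomeomorph M 𝔼} (hc : c ∈ atlas 𝔼 M)
    (hc' : c' ∈ atlas 𝔼 M) {z : 𝔼} (hz : z ∈ c'.target) (hz' : c'.symm z ∈ c.source) :
    φ.inChart c' z = (φ.inChart c ((c ∘ c'.symm) z)).compContinuousLinearMap
      (fderiv ℝ (c ∘ c'.symm) z) := by
  have h : c.symm ((c ∘ c'.symm) z) = c'.symm z := c.left_inv hz'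
  unfold Form.inChart
  rw [mfderiv_symm_eq_comp_transition hc hc' hz hz', h]
  rfl

theorem mfderiv_transition_comp {c c' : OpenPartialHomeomorph M 𝔼} (hc : c ∈ atlas 𝔼 M)
    (hc' : c' ∈ atlas 𝔼 M) {x : M} (hx : x ∈ c.source) (hx' : x ∈ c'.source) :
    (fderiv ℝ (c ∘ c'.symm) (c' x)).comp (mfderiv (𝓡 n) (𝓡 n) c' x : 𝔼 →L[ℝ] 𝔼) =
      mfderiv (𝓡 n) (𝓡 n) c x := by
  have hz : c'.symm (c' x) ∈ c.source := by rwa [c'.left_inv hx']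
  have heq : c =ᶠ[nhds x] (c ∘ c'.symm) ∘ c' := by
    filter_upwards [c'.open_source.mem_nhds hx'] with w hw
    simp [c'.left_inv hw]
  rw [heq.mfderiv_eq, ← mfderiv_eq_fderiv]
  have h1 : MDifferentiableAt (𝓡 n) (𝓡 n) (c ∘ c'.symm) (c' x) :=
    ((contDiffAt_transition hc hc' (c'.map_source hx') hz).differentiableAt
      (by simp)).mdifferentiableAt
  exact (mfderiv_comp x h1 ((mdifferentiable_chart hc').mdifferentiableAt hx')).symm

omit [IsManifold (𝓡 n) ∞ M] in
theorem Form.SmoothOn.contDiffAt_inChart {r : ℕ} {φ : Form n M r} {U : Set M}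
    (hφ : φ.SmoothOn U) (hU : IsOpen U) {c : OpenPartialHomeomorph M 𝔼} (hc : c ∈ atlas 𝔼 M)
    {z : 𝔼} (hz : z ∈ c.target) (hzU : c.symm z ∈ U) : ContDiffAt ℝ ∞ (φ.inChart c) z :=
  (hφ c hc).contDiffAt ((c.symm.isOpen_inter_preimage hU).mem_nhds ⟨hz, hzU⟩)

/-- The exterior derivative of a form may be computed in any chart of the atlas. -/
theorem Form.d_eq_extDeriv_inChart {r : ℕ} {φ : Form n M r} {c : OpenPartialHomeomorph M 𝔼}
    (hc : c ∈ atlas 𝔼 M) {x : M} (hx : x ∈ c.source)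
    (hφ : DifferentiableAt ℝ (φ.inChart c) (c x)) :
    φ.d x = (extDeriv (φ.inChart c) (c x)).compContinuousLinearMap
      (mfderiv (𝓡 n) (𝓡 n) c x) := by
  set c' := chartAt 𝔼 x
  have hc' : c' ∈ atlas 𝔼 M := chart_mem_atlas 𝔼 x
  have hx' : x ∈ c'.source := mem_chart_source 𝔼 x
  have hz := c'.map_source hx'
  have hz' : c'.symm (c' x) ∈ c.source := by rwa [c'.left_inv hx']
  have hτ : (c ∘ c'.symm) (c' x) = c x := congrArg c (c'.left_inv hx')
  have heq : φ.inChart c' =ᶠ[nhds (c' x)] fun z =>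
      (φ.inChart c ((c ∘ c'.symm) z)).compContinuousLinearMap (fderiv ℝ (c ∘ c'.symm) z) := by
    filter_upwards [(c'.symm.continuousAt hz).preimage_mem_nhds (c.open_source.mem_nhds hz'),
      c'.open_target.mem_nhds hz] with w hw hw'
    exact inChart_eq_compContinuousLinearMap_transition φ hc hc' hw' hw
  -- Independence of the chart is naturality of `d` under the transition map.
  have hpull := extDeriv_pullback (𝕜 := ℝ) (r := ∞)
    (hτ.symm ▸ hφ : DifferentiableAt ℝ (φ.inChart c) ((c ∘ c'.symm) (c' x)))
    (contDiffAt_transition hc hc' hz hz')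
    (by simpa using WithTop.coe_le_coe.2 (le_top : (2 : ℕ∞) ≤ ⊤))
  rw [hτ] at hpull
  change (extDeriv (φ.inChart c') (c' x)).compContinuousLinearMap
    (mfderiv (𝓡 n) (𝓡 n) c' x) = _
  rw [heq.extDeriv_eq, hpull, ← mfderiv_transition_comp hc hc' hx hx']
  rfl

omit [IsManifold (𝓡 n) ∞ M] in
theorem diff_eq_ofSubsingleton_comp {f : M → ℝ} {x : M} {L : 𝔼 →L[ℝ] ℝ}
    {A : TangentSpace (𝓡 n) x →L[ℝ] 𝔼} (h : mvfderiv (𝓡 n) f x = L.comp A) :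
    diff n f x = (ContinuousAlternatingMap.ofSubsingleton ℝ 𝔼 ℝ (0 : Fin 1)
      L).compContinuousLinearMap A := by
  rw [diff, h]
  rfl

theorem mvfderiv_eq_fderiv_comp_mfderiv {f : M → ℝ} (hf : ContMDiff (𝓡 n) 𝓘(ℝ) ∞ f)
    {c : OpenPartialHomeomorph M 𝔼} (hc : c ∈ atlas 𝔼 M) {x : M} (hx : x ∈ c.source) :
    mvfderiv (𝓡 n) f x = (fderiv ℝ (f ∘ c.symm) (c x)).comp
      (mfderiv (𝓡 n) (𝓡 n) c x : TangentSpace (𝓡 n) x →L[ℝ] 𝔼) := by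
  have heq : f =ᶠ[nhds x] (f ∘ c.symm) ∘ c := by
    filter_upwards [c.open_source.mem_nhds hx] with w hw
    simp [c.left_inv hw]
  have h1 : MDifferentiableAt (𝓡 n) 𝓘(ℝ) (f ∘ c.symm) (c x) :=
    (hf.mdifferentiableAt (by simp)).comp _
      ((mdifferentiable_chart hc).mdifferentiableAt_symm (c.map_source hx))
  have h2 := mfderiv_comp x h1 ((mdifferentiable_chart hc).mdifferentiableAt hx)
  rw [← heq.mfderiv_eq] at h2
  rw [← mfderiv_eq_fderiv]
  exact h2

theorem contDiffAt_comp_chart_symm {f : M → ℝ} (hf : ContMDiff (𝓡 n) 𝓘(ℝ) ∞ f)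
    {c : OpenPartialHomeomorph M 𝔼} (hc : c ∈ atlas 𝔼 M) {z : 𝔼} (hz : z ∈ c.target) :
    ContDiffAt ℝ ∞ (f ∘ c.symm) z := by
  rw [← contMDiffAt_iff_contDiffAt]
  exact hf.contMDiffAt.comp z ((contMDiffOn_symm_of_mem_maximalAtlas (I := 𝓡 n) (n := ∞)
    (IsManifold.subset_maximalAtlas hc)).contMDiffAt (c.open_target.mem_nhds hz))

/-- The form on `M` whose expression in the chart `c` is `β`. -/
def ofChart {r : ℕ} (c : OpenPartialHomeomorph M 𝔼) (β : 𝔼 → 𝔼 [⋀^Fin r]→L[ℝ] ℝ) : Form n M r :=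
  fun x => (β (c x)).compContinuousLinearMap (mfderiv (𝓡 n) (𝓡 n) c x)

theorem inChart_ofChart {r : ℕ} {c : OpenPartialHomeomorph M 𝔼} (hc : c ∈ atlas 𝔼 M)
    (β : 𝔼 → 𝔼 [⋀^Fin r]→L[ℝ] ℝ) {z : 𝔼} (hz : z ∈ c.target) :
    (ofChart c β : Form n M r).inChart c z = β z := by
  have h := (mdifferentiable_chart hc).comp_symm_deriv hz
  unfold Form.inChart ofChart
  rw [c.right_inv hz]
  change (β z).compContinuousLinearMap ((mfderiv (𝓡 n) (𝓡 n) c (c.symm z)).comp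
    (mfderiv (𝓡 n) (𝓡 n) c.symm z)) = β z
  rw [h]
  rfl

theorem ofChart_inChart {r : ℕ} {c : OpenPartialHomeomorph M 𝔼} (hc : c ∈ atlas 𝔼 M)
    (φ : Form n M r) {x : M} (hx : x ∈ c.source) :
    (φ.inChart c (c x)).compContinuousLinearMap (mfderiv (𝓡 n) (𝓡 n) c x) = φ x := by
  have h := (mdifferentiable_chart hc).symm_comp_deriv hx
  -- The point `c.symm (c x)` is generalized to `y`, since the type of `φ y` depends on it.
  have h' : ∀ y, y = x → ∀ A : 𝔼 →L[ℝ] 𝔼,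
      A.comp (mfderiv (𝓡 n) (𝓡 n) c x : 𝔼 →L[ℝ] 𝔼) = ContinuousLinearMap.id ℝ 𝔼 →
      ((φ y : 𝔼 [⋀^Fin r]→L[ℝ] ℝ).compContinuousLinearMap A).compContinuousLinearMap
        (mfderiv (𝓡 n) (𝓡 n) c x : 𝔼 →L[ℝ] 𝔼) = φ x := by
    rintro y rfl A hA
    change (φ y : 𝔼 [⋀^Fin r]→L[ℝ] ℝ).compContinuousLinearMap (A.comp _) = φ y
    rw [hA]
    rfl
  exact h' _ (c.left_inv hx) _ h

/-- In any other chart of the atlas the form is the pullback of `β` by a smooth transition map. -/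
theorem smoothOn_ofChart {r : ℕ} {c : OpenPartialHomeomorph M 𝔼} (hc : c ∈ atlas 𝔼 M)
    {β : 𝔼 → 𝔼 [⋀^Fin r]→L[ℝ] ℝ} {B : Set 𝔼} (hB : IsOpen B) (hβ : ContDiffOn ℝ ∞ β B) :
    (ofChart c β : Form n M r).SmoothOn (c.source ∩ c ⁻¹' B) := by
  rintro c' hc' z ⟨hz, hzc, hzB⟩
  refine ContDiffAt.contDiffWithinAt ?_
  have hτ := contDiffAt_transition hc hc' hz hzc
  have hβ' : ContDiffAt ℝ ∞ β ((c ∘ c'.symm) z) := hβ.contDiffAt (hB.mem_nhds hzB)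
  have h := contDiffAt_compContinuousLinearMap (hβ'.comp z hτ)
    (hτ.fderiv_right (m := ∞) (by simp))
  refine h.congr_of_eventuallyEq ?_
  filter_upwards [(c'.symm.continuousAt hz).preimage_mem_nhds (c.open_source.mem_nhds hzc),
    c'.open_target.mem_nhds hz] with w hw hw'
  rw [inChart_eq_compContinuousLinearMap_transition _ hc hc' hw' hw,
    inChart_ofChart hc β (show (c ∘ c'.symm) w ∈ c.target from c.map_source hw)]
  rfl

end Manifold

end ManifoldForm

end

/-! ### The theorem, by transport to the preferred chart at the point. -/

open ManifoldForm in
theorem proposition1p1 {n : ℕ} {M : Type*} [TopologicalSpace M]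
    [ChartedSpace (EuclideanSpace ℝ (Fin n)) M] [IsManifold (𝓡 n) ∞ M]
    (f : M → ℝ) (hf : ContMDiff (𝓡 n) 𝓘(ℝ) ∞ f) (hpos : ∀ x, 0 < f x)
    (r : ℕ) (U : Set M) (hU : IsOpen U)
    (φ : ManifoldForm.Form n M (r + 1)) (hφ : φ.SmoothOn U)
    (hd : ∀ x ∈ U, φ.dAttached f x = 0) :
    ∀ x ∈ U, ∃ U' : Set M, IsOpen U' ∧ x ∈ U' ∧ U' ⊆ U ∧
      ∃ ψ : ManifoldForm.Form n M r, ψ.SmoothOn U' ∧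
        ∀ y ∈ U', φ.wedge (ManifoldForm.diff n f) y = ψ.d.wedge (ManifoldForm.diff n f) y := by
  intro x hx
  set c := chartAt (EuclideanSpace ℝ (Fin n)) x
  have hc : c ∈ atlas (EuclideanSpace ℝ (Fin n)) M := chart_mem_atlas _ x
  have hxc : x ∈ c.source := mem_chart_source _ x
  have hV : IsOpen (c.target ∩ c.symm ⁻¹' U) := c.symm.isOpen_inter_preimage hU
  have hdφ : ∀ y ∈ c.source, y ∈ U → φ.d y =
      (extDeriv (φ.inChart c) (c y)).compContinuousLinearMap (chartDeriv c y) :=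
    fun y hy hyU => Form.d_eq_extDeriv_inChart hc hy
      ((hφ.contDiffAt_inChart hU hc (c.map_source hy)
        (by rwa [c.left_inv hy])).differentiableAt (by simp))
  have hφc : ∀ y ∈ c.source, φ y = (φ.inChart c (c y)).compContinuousLinearMap (chartDeriv c y) :=
    fun y hy => (ofChart_inChart hc φ hy).symm
  have hdiff : ∀ y ∈ c.source, diff n f y =
      (ContinuousAlternatingMap.ofSubsingleton ℝ _ ℝ (0 : Fin 1)
        (fderiv ℝ (f ∘ c.symm) (c y))).compContinuousLinearMap (chartDeriv c y) :=
    fun y hy => diff_eq_ofSubsingleton_comp (mvfderiv_eq_fderiv_comp_mfderiv hf hc hy)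
  have hdchart : ∀ z ∈ c.target ∩ c.symm ⁻¹' U,
      (f ∘ c.symm) z • extDeriv (φ.inChart c) z = ((r + 1 : ℕ) : ℝ) •
        ContinuousAlternatingMap.alternatizeUncurryFin
          ((fderiv ℝ (f ∘ c.symm) z).smulRight (φ.inChart c z)) := by
    rintro z ⟨hz, hzU⟩
    have hy := c.map_target hz
    have h := hd (c.symm z) hzU
    rw [Form.dAttached, Form.wedge, hdφ _ hy hzU, hdiff _ hy,
      hφc _ hy, ← wedge_compContinuousLinearMap,
      ← castDeg_compContinuousLinearMap, c.right_inv hz,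
      castDeg_wedge_eq_alternatizeUncurryFin, sub_eq_zero] at h
    have hinv := (mdifferentiable_chart hc).comp_symm_deriv hz
    ext v
    -- Evaluating on images under the derivative of `c.symm` cancels the pullback by `c`.
    have h2 := DFunLike.congr_fun h fun i => mfderiv (𝓡 n) (𝓡 n) c.symm z (v i)
    have h3 : ∀ i, chartDeriv c (c.symm z) (mfderiv (𝓡 n) (𝓡 n) c.symm z (v i)) = v i :=
      fun i => DFunLike.congr_fun hinv (v i)
    simp only [ContinuousAlternatingMap.smul_apply,
      ContinuousAlternatingMap.compContinuousLinearMap_apply, Function.comp_def, h3] at h2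
    exact h2
  obtain ⟨ε, hε, hball, β, hβ, hwedge⟩ := exists_wedge_eq_extDeriv_wedge hV
    (fun z hz => (contDiffAt_comp_chart_symm hf hc hz.1).contDiffWithinAt)
    (fun z _ => hpos (c.symm z)) (hφ c hc) hdchart
    (y₀ := c x) ⟨c.map_source hxc, by simpa [c.left_inv hxc] using hx⟩
  have hsub : ∀ y ∈ c.source ∩ c ⁻¹' Metric.ball (c x) ε, y ∈ U := by
    rintro y ⟨hy, hyB⟩
    have := (hball hyB).2
    rwa [Set.mem_preimage, c.left_inv hy] at this
  refine ⟨c.source ∩ c ⁻¹' Metric.ball (c x) ε, c.isOpen_inter_preimage Metric.isOpen_ball,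
    ⟨hxc, Metric.mem_ball_self hε⟩, hsub, ofChart c β,
    smoothOn_ofChart hc Metric.isOpen_ball hβ, ?_⟩
  rintro y ⟨hy, hyB⟩
  have hevent : (ofChart c β : Form n M r).inChart c =ᶠ[nhds (c y)] β := by
    filter_upwards [c.open_target.mem_nhds (c.map_source hy)] with w hw
    exact inChart_ofChart hc β hw
  have hdψ : (ofChart c β : Form n M r).d y =
      (extDeriv β (c y)).compContinuousLinearMap (chartDeriv c y) := by
    rw [← hevent.extDeriv_eq]
    refine Form.d_eq_extDeriv_inChart hc hy ?_
    exact ((hβ.contDiffAt (Metric.isOpen_ball.mem_nhds hyB)).differentiableAt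
      (by simp)).congr_of_eventuallyEq hevent
  rw [Form.wedge, Form.wedge, hdψ, hdiff y hy, hφc y hy,
    ← wedge_compContinuousLinearMap, ← wedge_compContinuousLinearMap, hwedge _ hyB]
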